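/- Let $(\mathcal M,\tau)$ be a noncommutative probability space, i.e. a von Neumann algebra $\mathcal M$ with a normal state $\tau$. The law of a self-adjoint $A\in\mathcal M$ is the unique probability measure $\mathcal L(A)$ on $\mathbb R$ with $\tau(A^k)=\int x^k\,d\mathcal L(A)(x)$ for all $k\ge 0$. Two self-adjoint elements $X,B\in\mathcal M$ are Boolean independent if, for all finite sequences of integers $k_1,k_2,\dots\ge 1$, $$\tau(X^{k_1}B^{k_2}X^{k_3}\cdots)=\tau(X^{k_1})\tau(B^{k_2})\tau(X^{k_3})\cdots,\qquad \tau(B^{k_1}X^{k_2}B^{k_3}\cdots)=\tau(B^{k_1})\tau(X^{k_2})\tau(B^{k_3})\cdots.$$ For a compactly supported probability measure $\mu$ on $\mathbb R$, put $$\Gamma(\mu)=\int\log|x|\,d\mu(x)\in[-\infty,+\infty),\qquad \Psi(\mu)=\iint\frac{\log x^2-\log y^2}{x^2-y^2}\,d\mu(x)\,d\mu(y)\in(0,+\infty],$$ where $\log 0=-\infty$ and the kernel of $\Psi$ is extended by continuity, with value $1/x^2$ if $x^2=y^2\neq 0$ and value $+\infty$ if $x=0$ or $y=0$. For a self-adjoint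 $A\in\mathcal M$ write $\Gamma(A)=\Gamma(\mathcal L(A))$ and $\Psi(A)=\Psi(\mathcal L(A))$. **Theorem (Boolean de Bruijn identity).** Let $X\in\mathcal M$ be self-adjoint with symmetric law, and let $B\in\mathcal M$ be self-adjoint, Boolean independent of $X$, with Rademacher law $\frac12\delta_{-1}+\frac12\delta_1$. Let $t\ge 0$ be such that $\Gamma(X+\sqrt s\,B)<+\infty$ and $\Psi(X+\sqrt s\,B)<+\infty$ for every $s\in[0,t]$. Then $\Gamma(X+\sqrt s\,B)$ is a finite real number for every $s\in[0,t]$, the function $s\mapsto\Psi(X+\sqrt s\,B)$ is integrable on $[0,t]$, and $$\Gamma(X+\sqrt t\,B)-\Gamma(X)=\int_0^t\tfrac12\,\Psi(X+\sqrt s\,B)\,ds.$$ In particular, $s\mapsto\Gamma(X+\sqrt s\,B)$ is (strictly) increasing on $[0,t]$. -/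

import Mathlib

open MeasureTheory Set
open scoped ENNReal ComplexOrder

noncomputable section

namespace BooleanEntropy

section NoncommutativeProbability

variable {M : Type*} [CStarAlgebra M] [PartialOrder M] [StarOrderedRing M]

/-- A positive linear functional on a von Neumann algebra is normal if it preserves suprema of
upward directed sets. -/
def IsNormal (τ : M →ₚ[ℂ] ℂ) : Prop :=
  ∀ D : Set M, D.Nonempty → DirectedOn (· ≤ ·) D → ∀ x : M, IsLUB D x → IsLUB (τ '' D) (τ x)

/-- The probability measure `μ` on `ℝ` has all its moments, and they are the moments `τ (a ^ k)`
of the noncommutative random variable `a`. -/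
structure IsLaw (τ : M →ₚ[ℂ] ℂ) (a : M) (μ : Measure ℝ) : Prop where
  isProbabilityMeasure : IsProbabilityMeasure μ
  integrable_pow : ∀ k : ℕ, Integrable (fun x : ℝ => x ^ k) μ
  moment_eq : ∀ k : ℕ, τ (a ^ k) = ((∫ x, x ^ k ∂μ : ℝ) : ℂ)

/-- The law of `a`: the probability measure on `ℝ` whose moments are those of `a`. For a
self-adjoint `a` and a state `τ` there is exactly one such measure. -/
def law (τ : M →ₚ[ℂ] ℂ) (a : M) : Measure ℝ := Classical.epsilon (IsLaw τ a)

/-- The alternating product `a ^ k₁ * b ^ k₂ * a ^ k₃ * ⋯`. -/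
def altProd (a b : M) : List ℕ → M
  | [] => 1
  | k :: ks => a ^ k * altProd b a ks

/-- The product of moments `τ (a ^ k₁) * τ (b ^ k₂) * τ (a ^ k₃) * ⋯`. -/
def altMoment (τ : M →ₚ[ℂ] ℂ) (a b : M) : List ℕ → ℂ
  | [] => 1
  | k :: ks => τ (a ^ k) * altMoment τ b a ks

/-- Boolean independence of two self-adjoint variables: the state is multiplicative on alternating
products of powers with exponents at least one, starting with either variable. -/
def BooleanIndep (τ : M →ₚ[ℂ] ℂ) (a b : M) : Prop :=
  ∀ ks : List ℕ, (∀ k ∈ ks, 1 ≤ k) →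
    τ (altProd a b ks) = altMoment τ a b ks ∧ τ (altProd b a ks) = altMoment τ b a ks

end NoncommutativeProbability

/-- A measure on `ℝ` is symmetric if it is invariant under `x ↦ -x`. -/
def IsSymm (μ : Measure ℝ) : Prop := μ.map (fun x => -x) = μ

/-- The Rademacher law `(δ₋₁ + δ₁) / 2`. -/
def rademacher : Measure ℝ :=
  (2⁻¹ : ℝ≥0∞) • Measure.dirac (-1) + (2⁻¹ : ℝ≥0∞) • Measure.dirac 1

/-- The Boolean entropy `Γ(μ) = ∫ log |x| dμ(x)`, an extended real number: the integral of the
positive part minus the integral of the negative part, where `log 0 = -∞`. -/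
def entropy (μ : Measure ℝ) : EReal :=
  ((∫⁻ x, (ENNReal.log ‖x‖ₑ).toENNReal ∂μ : ℝ≥0∞) : EReal)
    - ((∫⁻ x, (-ENNReal.log ‖x‖ₑ).toENNReal ∂μ : ℝ≥0∞) : EReal)

open Classical in
/-- The kernel `(log x² - log y²) / (x² - y²)`, extended by continuity to `x² = y²` (with value
`1 / x²`) and to `x = 0` or `y = 0` (with value `+∞`, as `log 0 = -∞`). -/
def fisherKernel (x y : ℝ) : ℝ≥0∞ :=
  if x = 0 ∨ y = 0 then ⊤
  else if x ^ 2 = y ^ 2 then ENNReal.ofReal (1 / x ^ 2)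
  else ENNReal.ofReal ((Real.log (x ^ 2) - Real.log (y ^ 2)) / (x ^ 2 - y ^ 2))

/-- The Boolean Fisher information `Ψ(μ)`. -/
def fisher (μ : Measure ℝ) : ℝ≥0∞ := ∫⁻ x, ∫⁻ y, fisherKernel x y ∂μ ∂μ

end BooleanEntropy

end

noncomputable section

namespace BooleanEntropy

/-! Everything is read off one transform, g_s(u) = ∫ (u + x²)⁻¹ dν_s(x) for u > 0, where ν_s is the
law of X + √s B.

In terms of g_s, Fisher information is Ψ(ν_s) = ∫₀^∞ g_s(u)² du (`fisher_eq_lintegral_sq`) and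
entropy is Γ(ν_s) = ½ ∫₀^∞ ((1 + u)⁻¹ - g_s(u)) du (`entropy_eq_coe_integral_sqStieltjes`). Both
come from Fubini applied to elementary integrals in u. Finite Ψ and a second moment already make Γ
finite.

Boolean independence enters only through `sqStieltjes_law_add_smul`: 1/g_s = 1/g_0 + s. It comes
from the resolvent identity, in which Boolean independence factors the state, together with the
moments of B and the symmetry of X. Hence ∂g_s/∂s = -g_s², so that dΓ/ds = ½ ∫ g_s² = ½ Ψ.
`deBruijn_of_sqStieltjes` carries this out in integrated form, and strict monotonicity follows
because g_s(u) strictly decreases in s. -/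

theorem exists_aeval_near_cfc {M : Type*} [CStarAlgebra M] {a : M} (ha : IsSelfAdjoint a) {f : ℝ → ℝ} (hf : Continuous f)
    {ε : ℝ} (hε : 0 < ε) : ∃ p : Polynomial ℝ, ‖cfc f a - p.aeval a‖ ≤ ε ∧
      ∀ x, |x| ≤ ‖a‖ → |f x - p.eval x| ≤ ε := by
  obtain ⟨p, hp⟩ := exists_polynomial_near_of_continuousOn (-‖a‖) ‖a‖ f hf.continuousOn ε hε
  have hp' : ∀ x, |x| ≤ ‖a‖ → |f x - p.eval x| ≤ ε := fun x hx => by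
    rw [abs_sub_comm]; exact (hp x (abs_le.1 hx)).le
  refine ⟨p, ?_, hp'⟩
  rw [← cfc_polynomial p a, ← cfc_sub f p.eval a hf.continuousOn p.continuous.continuousOn]
  refine norm_cfc_le hε.le fun x hx => hp' x ?_
  obtain _ | _ := subsingleton_or_nontrivial M
  · simp [spectrum.of_subsingleton] at hx
  · exact spectrum.norm_le_norm_of_mem hx

/-! ### Laws of self-adjoint elements and functional calculus. -/

section Law

variable {M : Type*} [CStarAlgebra M] [PartialOrder M]

theorem IsLaw.apply_aeval {τ : M →ₚ[ℂ] ℂ} {a : M} {μ : Measure ℝ} (h : IsLaw τ a μ)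
    (p : Polynomial ℝ) : τ (p.aeval a) = ((∫ x, p.eval x ∂μ : ℝ) : ℂ) := by
  simp only [Polynomial.aeval_eq_sum_range, Polynomial.eval_eq_sum_range]
  rw [integral_finsetSum _ fun i _ => (h.integrable_pow i).const_mul _, map_sum]
  push_cast
  refine Finset.sum_congr rfl fun i _ => ?_
  rw [← Complex.coe_smul, map_smul, h.moment_eq, integral_const_mul]
  simp

variable [StarOrderedRing M]

/-- Riesz–Markov–Kakutani on the compact spectrum, applied to f ↦ τ(f(a)), then pushed forward to ℝ.
-/
theorem exists_isLaw (τ : M →ₚ[ℂ] ℂ) (hτ : τ 1 = 1) {a : M} (ha : IsSelfAdjoint a) :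
    ∃ μ, IsLaw τ a μ := by
  have hreal : ∀ x : M, 0 ≤ x → (τ x).im = 0 := fun x hx =>
    ((Complex.nonneg_iff.1 (τ.map_nonneg hx)).2).symm
  let Λ₀ : CompactlySupportedContinuousMap (spectrum ℝ a) ℝ →ₗ[ℝ] ℝ :=
    { toFun := fun f => (τ (cfcHom ha (R := ℝ) f.toContinuousMap)).re
      map_add' := fun f g => by
        have : (f + g).toContinuousMap = f.toContinuousMap + g.toContinuousMap := rfl
        rw [this, map_add, map_add, Complex.add_re]
      map_smul' := fun c f => by
        have : (c • f).toContinuousMap = c • f.toContinuousMap := rfl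
        rw [this, map_smul, ← Complex.coe_smul, map_smul]
        simp }
  let Λ : CompactlySupportedContinuousMap (spectrum ℝ a) ℝ →ₚ[ℝ] ℝ :=
    PositiveLinearMap.mk₀ Λ₀ fun f hf =>
      (Complex.nonneg_iff.1 (τ.map_nonneg ((cfcHom_nonneg_iff ha).2 hf))).1
  have hint : ∀ f : C(spectrum ℝ a, ℝ), ∫ x, f x ∂(RealRMK.rieszMeasure Λ)
      = (τ (cfcHom ha (R := ℝ) f)).re := fun f =>
    RealRMK.integral_rieszMeasure Λ ⟨f, HasCompactSupport.of_compactSpace f⟩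
  have hpow : ∀ k : ℕ, ∫ x : spectrum ℝ a, (x : ℝ) ^ k ∂(RealRMK.rieszMeasure Λ)
      = (τ (a ^ k)).re := fun k => by
    have := hint ((ContinuousMap.restrict (spectrum ℝ a) (.id ℝ)) ^ k)
    rw [map_pow, cfcHom_id] at this
    exact this
  have hprob : IsProbabilityMeasure (RealRMK.rieszMeasure Λ) := by
    have := hpow 0
    simp only [pow_zero, hτ, integral_const, smul_eq_mul, mul_one, Complex.one_re] at this
    constructor
    rwa [measureReal_def, ENNReal.toReal_eq_one_iff] at this
  refine ⟨(RealRMK.rieszMeasure Λ).map Subtype.val,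
    Measure.isProbabilityMeasure_map measurable_subtype_coe.aemeasurable, fun k => ?_, fun k => ?_⟩
  · rw [integrable_map_measure (by fun_prop) (by fun_prop)]
    exact ((ContinuousMap.restrict (spectrum ℝ a) (.id ℝ)) ^ k).continuous.integrable_of_hasCompactSupport
      (HasCompactSupport.of_compactSpace _)
  · rw [integral_map (by fun_prop) (by fun_prop), hpow]
    have hs : IsSelfAdjoint (τ (a ^ k)) := by
      exact (ha.pow k).map τ
    exact (Complex.conj_eq_iff_re.1 hs).symm

theorem isLaw_law (τ : M →ₚ[ℂ] ℂ) (hτ : τ 1 = 1) {a : M} (ha : IsSelfAdjoint a) :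
    IsLaw τ a (law τ a) := Classical.epsilon_spec (exists_isLaw τ hτ ha)

/-- Even moments grow at most like ‖a‖^(2k), so Markov's inequality leaves no mass beyond any r >
‖a‖. This support bound makes polynomial approximation on [-‖a‖, ‖a‖] sufficient. -/
theorem IsLaw.ae_abs_le_norm {τ : M →ₚ[ℂ] ℂ} {a : M} {μ : Measure ℝ} (h : IsLaw τ a μ) :
    ∀ᵐ x ∂μ, |x| ≤ ‖a‖ := by
  have := h.isProbabilityMeasure
  obtain ⟨C, hC⟩ := τ.exists_norm_apply_le
  have key : ∀ r : ℝ, ‖a‖ < r → μ {x | r ≤ |x|} = 0 := by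
    intro r hr
    have hr0 : 0 < r := (norm_nonneg a).trans_lt hr
    have hb : ∀ k : ℕ, μ.real {x | r ≤ |x|} ≤ C * ‖(1 : M)‖ * ((‖a‖ / r) ^ 2) ^ k := by
      intro k
      have h1 := mul_meas_ge_le_integral_of_nonneg (μ := μ) (f := fun x : ℝ => x ^ (2 * k))
        (Filter.Eventually.of_forall fun x => (even_two_mul k).pow_nonneg x)
        (h.integrable_pow _) (r ^ (2 * k))
      have h2 : ∫ x, x ^ (2 * k) ∂μ ≤ C * (‖(1 : M)‖ * ‖a‖ ^ (2 * k)) := by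
        have h3 := hC (a ^ (2 * k))
        rw [h.moment_eq, Complex.norm_real] at h3
        refine (Real.le_norm_self _).trans (h3.trans ?_)
        gcongr
        -- The factor ‖1‖ is kept because the exponent may be 0 and ‖1‖ = 1 is not assumed.
        calc ‖a ^ (2 * k)‖ = ‖1 * a ^ (2 * k)‖ := by rw [one_mul]
          _ ≤ _ := by
            induction 2 * k with
            | zero => simp
            | succ n ih =>
              rw [pow_succ, ← mul_assoc, pow_succ, ← mul_assoc]
              exact (norm_mul_le _ _).trans (by gcongr)
      have h4 : μ.real {x | r ≤ |x|} ≤ μ.real {x | r ^ (2 * k) ≤ x ^ (2 * k)} := by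
        refine measureReal_mono fun x hx => ?_
        have := pow_le_pow_left₀ hr0.le hx (2 * k)
        simpa [pow_mul, sq_abs] using this
      rw [← pow_mul, div_pow, mul_div_assoc', le_div_iff₀ (by positivity)]
      nlinarith [pow_pos hr0 (2 * k)]
    have hlim : Filter.Tendsto (fun k : ℕ => C * ‖(1 : M)‖ * ((‖a‖ / r) ^ 2) ^ k) Filter.atTop
        (nhds (C * ‖(1 : M)‖ * 0)) := by
      refine (tendsto_pow_atTop_nhds_zero_of_lt_one (by positivity) ?_).const_mul _
      exact pow_lt_one₀ (by positivity) ((div_lt_one hr0).2 hr) two_ne_zero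
    have := ge_of_tendsto' hlim hb
    rw [mul_zero] at this
    exact (measureReal_eq_zero_iff).1 (le_antisymm this measureReal_nonneg)
  have hall : ∀ᵐ x ∂μ, ∀ n : ℕ, |x| < ‖a‖ + 1 / (n + 1) := by
    rw [ae_all_iff]
    intro n
    have := key (‖a‖ + 1 / (n + 1)) (lt_add_of_pos_right _ Nat.one_div_pos_of_nat)
    rw [ae_iff]
    simpa using this
  filter_upwards [hall] with x hx
  refine le_of_forall_pos_lt_add fun ε hε => ?_
  obtain ⟨n, hn⟩ := exists_nat_one_div_lt hε
  linarith [hx n]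

/-- Weierstrass approximation passes the moment identity from polynomials to continuous functions.
-/
theorem IsLaw.apply_cfc {τ : M →ₚ[ℂ] ℂ} {a : M} {μ : Measure ℝ} (h : IsLaw τ a μ)
    (ha : IsSelfAdjoint a) {f : ℝ → ℝ} (hf : Continuous f) :
    τ (cfc f a) = ((∫ x, f x ∂μ : ℝ) : ℂ) := by
  have := h.isProbabilityMeasure
  obtain ⟨C, hC⟩ := τ.exists_norm_apply_le
  have hfi : Integrable f μ := by
    obtain ⟨K, hK⟩ := (isCompact_Icc (a := -‖a‖) (b := ‖a‖)).exists_bound_of_continuousOn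
      hf.continuousOn
    refine Integrable.of_bound hf.aestronglyMeasurable K ?_
    filter_upwards [h.ae_abs_le_norm] with x hx using hK x (abs_le.1 hx)
  refine eq_of_forall_dist_le fun δ hδ => ?_
  -- The two errors add up to (C + 1) times this tolerance, that is δ; the +1 also keeps the
  -- denominator nonzero.
  obtain ⟨p, hp1, hp2⟩ := exists_aeval_near_cfc ha hf (ε := δ / (C + 1)) (by positivity)
  have hpi : Integrable (fun x => p.eval x) μ := by
    simp only [Polynomial.eval_eq_sum_range]
    exact integrable_finsetSum _ fun i _ => (h.integrable_pow i).const_mul _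
  have h1 : ‖τ (cfc f a) - τ (p.aeval a)‖ ≤ C * (δ / (C + 1)) := by
    rw [← map_sub]
    exact (hC _).trans (by gcongr)
  have h2 : ‖τ (p.aeval a) - ((∫ x, f x ∂μ : ℝ) : ℂ)‖ ≤ δ / (C + 1) := by
    rw [h.apply_aeval, ← Complex.ofReal_sub, Complex.norm_real, norm_sub_rev,
      ← integral_sub hfi hpi]
    refine (norm_integral_le_of_norm_le_const (C := δ / (C + 1)) ?_).trans (by simp)
    filter_upwards [h.ae_abs_le_norm] with x hx using hp2 x hx
  rw [dist_eq_norm]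
  calc _ ≤ ‖τ (cfc f a) - τ (p.aeval a)‖ + ‖τ (p.aeval a) - ((∫ x, f x ∂μ : ℝ) : ℂ)‖ :=
        norm_sub_le_norm_sub_add_norm_sub _ _ _
    _ ≤ C * (δ / (C + 1)) + δ / (C + 1) := add_le_add h1 h2
    _ = δ := by field_simp

end Law

/-- The integral `∫ (u + x²)⁻¹ dμ(x)`, which is up to sign the Cauchy transform at `-u` of the
image of `μ` under squaring. -/
def sqStieltjes (μ : Measure ℝ) (u : ℝ) : ℝ := ∫ x, (u + x ^ 2)⁻¹ ∂μ

/-- The span of all alternating products of positive powers of `a` and `b`. -/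
def altSpan {M : Type*} [CStarAlgebra M] (a b : M) : Submodule ℂ M :=
  Submodule.span ℂ
    {w | ∃ ks : List ℕ, (∀ k ∈ ks, 1 ≤ k) ∧ (w = altProd a b ks ∨ w = altProd b a ks)}

/-! ### Alternating words and resolvents on the imaginary axis. -/

section Words

variable {M : Type*} [CStarAlgebra M]

/-- A new letter `a` is absorbed into a leading power of `a`, or else opens a new block; either way
the exponents stay at least 1. -/
theorem exists_mul_eq_altProd {a b w : M} {ks : List ℕ} (hks : ∀ k ∈ ks, 1 ≤ k)
    (hw : w = altProd a b ks ∨ w = altProd b a ks) :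
    ∃ ls : List ℕ, ls ≠ [] ∧ (∀ k ∈ ls, 1 ≤ k) ∧ a * w = altProd a b ls := by
  rcases hw with rfl | rfl
  · cases ks with
    | nil => exact ⟨[1], by simp, by simp, by simp [altProd]⟩
    | cons k ks =>
      refine ⟨(k + 1) :: ks, by simp, fun l hl => ?_, by simp [altProd, pow_succ', mul_assoc]⟩
      rcases List.mem_cons.1 hl with rfl | hl
      · omega
      · exact hks l (List.mem_cons_of_mem _ hl)
  · refine ⟨1 :: ks, by simp, fun l hl => ?_, by simp [altProd]⟩
    rcases List.mem_cons.1 hl with rfl | hl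
    · exact le_rfl
    · exact hks l hl

theorem altSpan_comm (a b : M) : altSpan a b = altSpan b a := by
  simp only [altSpan, or_comm]

theorem one_mem_altSpan (a b : M) : (1 : M) ∈ altSpan a b :=
  Submodule.subset_span ⟨[], by simp, by simp [altProd]⟩

theorem mul_mem_altSpan_left {a b w : M} (hw : w ∈ altSpan a b) : a * w ∈ altSpan a b := by
  induction hw using Submodule.span_induction with
  | mem w hw =>
    obtain ⟨ks, hks, hw⟩ := hw
    obtain ⟨ls, -, hls, h⟩ := exists_mul_eq_altProd hks hw
    exact Submodule.subset_span ⟨ls, hls, Or.inl h⟩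
  | zero => simp
  | add x y _ _ hx hy => rw [mul_add]; exact add_mem hx hy
  | smul c x _ hx => rw [mul_smul_comm]; exact Submodule.smul_mem _ _ hx

theorem mul_mem_altSpan_right {a b w : M} (hw : w ∈ altSpan a b) : b * w ∈ altSpan a b := by
  rw [altSpan_comm] at hw ⊢
  exact mul_mem_altSpan_left hw

theorem aeval_add_smul_mem_altSpan (a b : M) (c : ℂ) (p : Polynomial ℝ) :
    p.aeval (a + c • b) ∈ altSpan a b := by
  have hpow : ∀ n : ℕ, (a + c • b) ^ n ∈ altSpan a b := fun n => by
    induction n with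
    | zero => simpa using one_mem_altSpan a b
    | succ n ih =>
      rw [pow_succ', add_mul, smul_mul_assoc]
      exact add_mem (mul_mem_altSpan_left ih) (Submodule.smul_mem _ _ (mul_mem_altSpan_right ih))
  rw [Polynomial.aeval_eq_sum_range]
  refine sum_mem fun i _ => ?_
  rw [← Complex.coe_smul]
  exact Submodule.smul_mem _ _ (hpow i)

theorem cfc_mem_closure_of_aeval_mem {a : M} (ha : IsSelfAdjoint a) {S : Set M}
    (hS : ∀ p : Polynomial ℝ, p.aeval a ∈ S) {f : ℝ → ℝ} (hf : Continuous f) :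
    cfc f a ∈ closure S := by
  rw [Metric.mem_closure_iff]
  intro ε hε
  obtain ⟨p, hp, -⟩ := exists_aeval_near_cfc ha hf (half_pos hε)
  exact ⟨p.aeval a, hS p, by rw [dist_eq_norm]; linarith⟩

/-- The resolvent `(i v - a)⁻¹` of a self-adjoint element, at a point of the imaginary axis. -/
def imResolvent (a : M) (v : ℝ) : M :=
  -(cfc (fun x : ℝ => x * (v ^ 2 + x ^ 2)⁻¹) a
    + (Complex.I * v) • cfc (fun x : ℝ => (v ^ 2 + x ^ 2)⁻¹) a)

theorem continuous_inv_sq_add_sq {v : ℝ} (hv : 0 < v) :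
    Continuous fun x : ℝ => (v ^ 2 + x ^ 2)⁻¹ :=
  Continuous.inv₀ (by fun_prop) fun x => by positivity

theorem imResolvent_mem_closure {a : M} (ha : IsSelfAdjoint a) {S : Submodule ℂ M}
    (hS : ∀ p : Polynomial ℝ, p.aeval a ∈ S) {v : ℝ} (hv : 0 < v) :
    imResolvent a v ∈ closure (S : Set M) := by
  have hc := continuous_inv_sq_add_sq hv
  have h1 := cfc_mem_closure_of_aeval_mem ha (S := S) hS (continuous_id.mul hc)
  have h2 := cfc_mem_closure_of_aeval_mem ha (S := S) hS hc
  rw [← Submodule.topologicalClosure_coe] at h1 h2 ⊢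
  exact neg_mem (add_mem h1 (Submodule.smul_mem _ _ h2))

/-- The scalar identity (iv - x)⁻¹ = -(x + iv)/(v² + x²) splits the resolvent into two real
functions, so the real functional calculus suffices. -/
theorem imResolvent_mul {a : M} (ha : IsSelfAdjoint a) {v : ℝ} (hv : 0 < v) :
    imResolvent a v * ((Complex.I * v) • 1 - a) = 1 ∧
      ((Complex.I * v) • 1 - a) * imResolvent a v = 1 := by
  have hc := continuous_inv_sq_add_sq hv
  have hc' : Continuous fun x : ℝ => x * (v ^ 2 + x ^ 2)⁻¹ := continuous_id.mul hc
  have h1 : a * cfc (fun x : ℝ => (v ^ 2 + x ^ 2)⁻¹) a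
      = cfc (fun x : ℝ => x * (v ^ 2 + x ^ 2)⁻¹) a := by
    rw [cfc_mul (fun x : ℝ => x) _ a (by fun_prop) hc.continuousOn, cfc_id' ℝ a]
  have h2 : a * cfc (fun x : ℝ => x * (v ^ 2 + x ^ 2)⁻¹) a
      = 1 - ((v : ℂ) ^ 2) • cfc (fun x : ℝ => (v ^ 2 + x ^ 2)⁻¹) a := by
    have e : (fun x : ℝ => x * (x * (v ^ 2 + x ^ 2)⁻¹))
        = fun x => 1 - v ^ 2 • (v ^ 2 + x ^ 2)⁻¹ := by
      funext x
      have : v ^ 2 + x ^ 2 ≠ 0 := by positivity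
      rw [smul_eq_mul]
      field_simp
      ring
    calc _ = cfc (fun x : ℝ => x * (x * (v ^ 2 + x ^ 2)⁻¹)) a := by
          rw [cfc_mul (fun x : ℝ => x) _ a (by fun_prop) hc'.continuousOn, cfc_id' ℝ a]
      _ = _ := by
          rw [e, cfc_sub (fun _ : ℝ => (1 : ℝ)) (fun x => v ^ 2 • (v ^ 2 + x ^ 2)⁻¹) a (by fun_prop) (hc.const_smul (v ^ 2)).continuousOn,
            cfc_smul (v ^ 2) (fun x : ℝ => (v ^ 2 + x ^ 2)⁻¹) a hc.continuousOn, cfc_const_one ℝ a, ← Complex.coe_smul,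
            Complex.ofReal_pow]
  have e0 : ∀ f : ℝ → ℝ, Commute a (cfc f a) := fun f => by
    simpa only [cfc_id' ℝ a] using cfc_commute_cfc (fun x : ℝ => x) f a
  have hright : ((Complex.I * v) • 1 - a) * imResolvent a v = 1 := by
    have : Complex.I * v * (Complex.I * v) = -(v : ℂ) ^ 2 := by
      ring_nf; simp
    simp only [imResolvent, mul_neg, sub_mul, mul_add, smul_mul_assoc, one_mul, mul_smul_comm, h1,
      h2, smul_sub, smul_smul, this, neg_smul]
    abel
  refine ⟨?_, hright⟩
  have : Commute (imResolvent a v) ((Complex.I * v) • 1 - a) := by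
    refine Commute.sub_right ((Commute.one_right _).smul_right _) ?_
    exact (((e0 _).add_right ((e0 _).smul_right _)).neg_right).symm
  rw [this.eq, hright]

end Words

/-! ### Boolean independence and the evolution of the transform. -/

section State

variable {M : Type*} [CStarAlgebra M] [PartialOrder M]

theorem integral_eq_zero_of_isSymm {μ : Measure ℝ} (h : IsSymm μ) {f : ℝ → ℝ}
    (hf : ∀ x, f (-x) = - f x) : ∫ x, f x ∂μ = 0 := by
  have h1 : ∫ x, f x ∂μ = ∫ x, f (-x) ∂μ := by
    conv_lhs => rw [← show μ.map (fun x => -x) = μ from h]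
    exact integral_map_equiv (MeasurableEquiv.neg ℝ) f
  simp only [hf, integral_neg] at h1
  linarith

theorem integral_pow_rademacher (k : ℕ) :
    ∫ x, x ^ k ∂rademacher = ((-1) ^ k + 1) / 2 := by
  rw [rademacher, integral_add_measure, integral_smul_measure, integral_smul_measure]
  · simp; ring
  · exact (integrable_dirac (by simp)).smul_measure (by simp)
  · exact (integrable_dirac (by simp)).smul_measure (by simp)

variable {τ : M →ₚ[ℂ] ℂ} {X B : M}

/-- `B * w` is a combination of words beginning with `B`, so the leading power of `X` factors out;
`τ 1 = 1` covers `j = 0`. -/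
theorem BooleanIndep.apply_pow_mul (h : BooleanIndep τ X B) (hτ : τ 1 = 1) (j : ℕ) {w : M}
    (hw : w ∈ altSpan X B) : τ (X ^ j * (B * w)) = τ (X ^ j) * τ (B * w) := by
  induction hw using Submodule.span_induction with
  | mem w hw =>
    obtain ⟨ks, hks, hw⟩ := hw
    obtain ⟨ls, -, hls, e⟩ := exists_mul_eq_altProd hks hw.symm
    rcases Nat.eq_zero_or_pos j with rfl | hj
    · simp [hτ]
    · have h1 := (h (j :: ls) (by simpa using ⟨hj, hls⟩)).1
      rw [altProd, altMoment, ← e, ← (h ls hls).2, ← e] at h1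
      exact h1
  | zero => simp
  | add x y _ _ hx hy => simp only [mul_add, map_add, hx, hy]
  | smul c x _ hx => simp only [mul_smul_comm, map_smul, hx, smul_eq_mul]; ring

theorem BooleanIndep.apply_mul_mul_eq_zero (h : BooleanIndep τ X B) (hB : τ B = 0) {w : M}
    (hw : w ∈ altSpan X B) : τ (B * (X * w)) = 0 := by
  induction hw using Submodule.span_induction with
  | mem w hw =>
    obtain ⟨ks, hks, hw⟩ := hw
    obtain ⟨ls, -, hls, e⟩ := exists_mul_eq_altProd hks hw
    have h1 := (h (1 :: ls) (by simpa using hls)).2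
    rw [altProd, altMoment, ← e, pow_one, hB, zero_mul] at h1
    exact h1
  | zero => simp
  | add x y _ _ hx hy => simp only [mul_add, map_add, hx, hy, add_zero]
  | smul c x _ hx => simp only [mul_smul_comm, map_smul, hx, smul_zero]

/-- B² = 1 need not hold in M, but the state sees only moments of B, which depend on the parity of
the exponent. -/
theorem BooleanIndep.apply_sq_mul (h : BooleanIndep τ X B) (hτ : τ 1 = 1)
    (hB : ∀ k, τ (B ^ (2 + k)) = τ (B ^ k)) {w : M}
    (hw : w ∈ altSpan X B) : τ (B ^ 2 * w) = τ w := by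
  have hB2 : τ (B ^ 2) = 1 := by simpa [hτ] using hB 0
  induction hw using Submodule.span_induction with
  | mem w hw =>
    obtain ⟨ks, hks, rfl | rfl⟩ := hw
    · have h1 := (h (2 :: ks) (by simpa using hks)).2
      rw [altProd, altMoment, hB2, one_mul, ← (h ks hks).1] at h1
      exact h1
    · cases ks with
      | nil => simp [altProd, hB2, hτ]
      | cons k ks =>
        rw [List.forall_mem_cons] at hks
        have h1 := (h ((2 + k) :: ks) (by simpa using ⟨by omega, hks.2⟩)).2
        have h2 := (h (k :: ks) (by simpa using hks)).2
        rw [altMoment, hB, ← altMoment, ← h2, altProd, pow_add, mul_assoc] at h1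
        exact h1
  | zero => simp
  | add x y _ _ hx hy => simp only [mul_add, map_add, hx, hy]
  | smul c x _ hx => simp only [mul_smul_comm, map_smul, hx]

variable [StarOrderedRing M]

theorem IsLaw.apply_imResolvent {a : M} {μ : Measure ℝ} (h : IsLaw τ a μ)
    (ha : IsSelfAdjoint a) {v : ℝ} (hv : 0 < v) :
    τ (imResolvent a v) = -(((∫ x, x * (v ^ 2 + x ^ 2)⁻¹ ∂μ : ℝ) : ℂ)
      + Complex.I * v * (sqStieltjes μ (v ^ 2) : ℂ)) := by
  have hc := continuous_inv_sq_add_sq hv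
  rw [imResolvent, map_neg, map_add, map_smul, h.apply_cfc ha hc,
    h.apply_cfc ha (f := fun x => x * (v ^ 2 + x ^ 2)⁻¹) (continuous_id.mul hc)]
  rfl

/-- With Q and R the two resolvents, τ of Q = R + cRBQ and of zBQ = B + BXQ + cB²Q gives two linear
equations in τ(Q) and τ(BQ); eliminating τ(BQ) yields the claim. The word identities reach Q and R
by continuity of τ, since resolvents are norm limits of polynomials. -/
theorem BooleanIndep.apply_imResolvent (h : BooleanIndep τ X B) (hτ : τ 1 = 1)
    (hX : IsSelfAdjoint X) {c : ℝ} (hY : IsSelfAdjoint (X + (c : ℂ) • B))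
    (hB : τ B = 0) (hB' : ∀ k, τ (B ^ (2 + k)) = τ (B ^ k)) {v : ℝ} (hv : 0 < v) :
    Complex.I * v * τ (imResolvent (X + (c : ℂ) • B) v)
      = Complex.I * v * τ (imResolvent X v)
        + c ^ 2 * τ (imResolvent X v) * τ (imResolvent (X + (c : ℂ) • B) v) := by
  have hτc : Continuous τ := map_continuous τ
  set Q := imResolvent (X + (c : ℂ) • B) v with hQ
  set R := imResolvent X v with hR
  set z : ℂ := Complex.I * v with hz
  have hQmem : Q ∈ closure (altSpan X B : Set M) :=
    imResolvent_mem_closure hY (aeval_add_smul_mem_altSpan X B c) hv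
  have hRmem : R ∈ closure (Submodule.span ℂ (Set.range fun j : ℕ => X ^ j) : Set M) := by
    refine imResolvent_mem_closure hX (fun p => ?_) hv
    rw [Polynomial.aeval_eq_sum_range]
    refine sum_mem fun i _ => ?_
    rw [← Complex.coe_smul]
    exact Submodule.smul_mem _ _ (Submodule.subset_span ⟨i, rfl⟩)
  have h0 : τ (B * (X * Q)) = 0 :=
    closure_minimal (t := {w | τ (B * (X * w)) = 0}) (fun w hw => by exact h.apply_mul_mul_eq_zero hB hw)
      (isClosed_eq (by fun_prop) (by fun_prop)) hQmem
  have h2 : τ (B ^ 2 * Q) = τ Q :=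
    closure_minimal (t := {w | τ (B ^ 2 * w) = τ w}) (fun w hw => by exact h.apply_sq_mul hτ hB' hw)
      (isClosed_eq (by fun_prop) (by fun_prop)) hQmem
  have hpow : ∀ j : ℕ, τ (X ^ j * (B * Q)) = τ (X ^ j) * τ (B * Q) := fun j =>
    closure_minimal (t := {w | τ (X ^ j * (B * w)) = τ (X ^ j) * τ (B * w)})
      (fun w hw => by exact h.apply_pow_mul hτ j hw) (isClosed_eq (by fun_prop) (by fun_prop)) hQmem
  have hRQ : τ (R * (B * Q)) = τ R * τ (B * Q) := by
    refine closure_minimal (t := {r | τ (r * (B * Q)) = τ r * τ (B * Q)}) (fun r hr => ?_)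
      (isClosed_eq (by fun_prop) (by fun_prop)) hRmem
    induction hr using Submodule.span_induction with
    | mem r hr => obtain ⟨j, rfl⟩ := hr; exact hpow j
    | zero => simp
    | add x y _ _ hx hy =>
      simp only [mem_ofPred_eq] at hx hy
      simp only [mem_ofPred_eq, add_mul, map_add, hx, hy]
    | smul a x _ hx =>
      simp only [mem_ofPred_eq] at hx
      simp only [mem_ofPred_eq, smul_mul_assoc, map_smul, hx, smul_eq_mul]; ring
  have hQ1 : (z • 1 - (X + (c : ℂ) • B)) * Q = 1 := (imResolvent_mul hY hv).2
  have hR1 : R * (z • 1 - X) = 1 := (imResolvent_mul hX hv).1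
  have e1 : Q = R + (c : ℂ) • (R * (B * Q)) := by
    calc Q = R * (z • 1 - X) * Q := by rw [hR1, one_mul]
      _ = R * ((z • 1 - (X + (c : ℂ) • B)) * Q) + (c : ℂ) • (R * (B * Q)) := by
        simp only [sub_mul, mul_sub, add_mul, mul_add, smul_mul_assoc, mul_smul_comm, mul_assoc]
        abel
      _ = _ := by rw [hQ1, mul_one]
  -- Multiply (z - X - cB)Q = 1 on the left by B.
  have e2 : z • (B * Q) = B * 1 + B * (X * Q) + (c : ℂ) • (B ^ 2 * Q) := by
    rw [← hQ1]
    simp only [sub_mul, mul_sub, add_mul, mul_add, smul_mul_assoc, mul_smul_comm, one_mul, sq,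
      mul_assoc]
    abel
  have f1 := congrArg τ e1
  have f2 := congrArg τ e2
  simp only [map_add, map_smul, hRQ, smul_eq_mul, h0, h2, mul_one, hB, zero_add] at f1 f2
  linear_combination z * f1 + c * τ R * f2

theorem sqStieltjes_law_add_smul (hτ : τ 1 = 1) (hX : IsSelfAdjoint X) (hB : IsSelfAdjoint B)
    (hX_symm : IsSymm (law τ X)) (hB_law : law τ B = rademacher) (h : BooleanIndep τ X B)
    {s : ℝ} (hs : 0 ≤ s) {u : ℝ} (hu : 0 < u) :
    sqStieltjes (law τ (X + ((√s : ℝ) : ℂ) • B)) u = sqStieltjes (law τ X) u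
      - s * (sqStieltjes (law τ X) u * sqStieltjes (law τ (X + ((√s : ℝ) : ℂ) • B)) u) := by
  have hY : IsSelfAdjoint (X + ((√s : ℝ) : ℂ) • B) :=
    hX.add (IsSelfAdjoint.smul (Complex.conj_ofReal _) hB)
  have hBlaw : IsLaw τ B rademacher := hB_law ▸ isLaw_law τ hτ hB
  have hBk : ∀ k : ℕ, τ (B ^ k) = ((((-1) ^ k + 1) / 2 : ℝ) : ℂ) := fun k => by
    rw [hBlaw.moment_eq, integral_pow_rademacher]
  have key := h.apply_imResolvent hτ hX hY (by simpa using hBk 1)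
    (fun k => by rw [hBk, hBk]; simp [pow_add]) (Real.sqrt_pos.2 hu)
  rw [(isLaw_law τ hτ hX).apply_imResolvent hX (Real.sqrt_pos.2 hu),
    (isLaw_law τ hτ hY).apply_imResolvent hY (Real.sqrt_pos.2 hu),
    integral_eq_zero_of_isSymm hX_symm (fun x => by simp), Real.sq_sqrt hu.le, ← Complex.ofReal_pow,
    Real.sq_sqrt hs] at key
  generalize law τ (X + ((√s : ℝ) : ℂ) • B) = ν at key ⊢
  -- By symmetry τ(R) is purely imaginary, so the real part eliminates the odd integral of the law
  -- of X + √s B without needing it to vanish.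
  have hre := congrArg Complex.re key
  simp only [mul_neg, Complex.neg_re, Complex.mul_re, Complex.I_re, Complex.ofReal_re, zero_mul,
    Complex.I_im, Complex.ofReal_im, mul_zero, sub_self, Complex.add_re, add_zero, Complex.mul_im,
    one_mul, Complex.add_im, zero_add, zero_sub, neg_neg, Complex.ofReal_zero, neg_mul] at hre
  refine mul_left_cancel₀ hu.ne' ?_
  linear_combination hre - (sqStieltjes ν u - sqStieltjes (law τ X) u
    + s * (sqStieltjes (law τ X) u * sqStieltjes ν u)) * Real.mul_self_sqrt hu.le

end State

/-! ### Entropy and Fisher information as integrals of the transform. -/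

section Analysis

theorem integrableOn_and_integral_inv_add_mul_inv_add {a b : ℝ} (ha : 0 < a) (hb : 0 < b) :
    IntegrableOn (fun u : ℝ => (u + a)⁻¹ * (u + b)⁻¹) (Ioi 0) ∧
      ∫ u in Ioi (0 : ℝ), (u + a)⁻¹ * (u + b)⁻¹
        = if a = b then 1 / a else (Real.log a - Real.log b) / (a - b) := by
  have hpos : ∀ u ∈ Ioi (0 : ℝ), 0 ≤ (u + a)⁻¹ * (u + b)⁻¹ := fun u hu => by
    have : 0 < u := hu
    positivity
  have htop : ∀ c : ℝ, Filter.Tendsto (fun u : ℝ => u + c) Filter.atTop Filter.atTop :=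
    fun c => Filter.tendsto_atTop_add_const_right _ _ Filter.tendsto_id
  split_ifs with hab
  · subst hab
    have hderiv : ∀ u ∈ Ici (0 : ℝ),
        HasDerivAt (fun u : ℝ => -(u + a)⁻¹) ((u + a)⁻¹ * (u + a)⁻¹) u := fun u hu => by
      have h0 : u + a ≠ 0 := by have : (0 : ℝ) ≤ u := hu; positivity
      convert! (((hasDerivAt_id u).add_const a).inv h0).neg using 1
      simp only [id]
      field_simp
    have hlim : Filter.Tendsto (fun u : ℝ => -(u + a)⁻¹) Filter.atTop (nhds 0) := by
      simpa using (tendsto_inv_atTop_zero.comp (htop a)).neg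
    refine ⟨integrableOn_Ioi_deriv_of_nonneg' hderiv hpos hlim, ?_⟩
    rw [integral_Ioi_of_hasDerivAt_of_nonneg' hderiv hpos hlim]
    simp
  · have hba : b - a ≠ 0 := sub_ne_zero.2 (Ne.symm hab)
    have hab' : a - b ≠ 0 := sub_ne_zero.2 hab
    have hderiv : ∀ u ∈ Ici (0 : ℝ),
        HasDerivAt (fun u : ℝ => (Real.log (u + a) - Real.log (u + b)) / (b - a))
          ((u + a)⁻¹ * (u + b)⁻¹) u := fun u hu => by
      have hu : (0 : ℝ) ≤ u := hu
      have h0 : u + a ≠ 0 := by positivity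
      have h1 : u + b ≠ 0 := by positivity
      convert! ((((hasDerivAt_id u).add_const a).log h0).sub
        (((hasDerivAt_id u).add_const b).log h1)).div_const (b - a) using 1
      simp only [id]
      field_simp
      ring
    have hlim : Filter.Tendsto (fun u : ℝ => (Real.log (u + a) - Real.log (u + b)) / (b - a))
        Filter.atTop (nhds 0) := by
      have h1 : Filter.Tendsto (fun u : ℝ => 1 + (a - b) * (u + b)⁻¹) Filter.atTop (nhds 1) := by
        simpa using ((tendsto_inv_atTop_zero.comp (htop b)).const_mul (a - b)).const_add 1
      have h2 := ((Real.continuousAt_log one_ne_zero).tendsto.comp h1).div_const (b - a)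
      rw [Real.log_one, zero_div] at h2
      refine h2.congr' ?_
      filter_upwards [Filter.eventually_ge_atTop 0] with u hu
      rw [Function.comp_apply, ← Real.log_div (by positivity) (by positivity)]
      congr 2
      have : u + b ≠ 0 := by positivity
      field_simp
      ring
    refine ⟨integrableOn_Ioi_deriv_of_nonneg' hderiv hpos hlim, ?_⟩
    rw [integral_Ioi_of_hasDerivAt_of_nonneg' hderiv hpos hlim]
    simp only [zero_add]
    field_simp
    ring

theorem fisherKernel_eq_lintegral {x y : ℝ} (hx : x ≠ 0) (hy : y ≠ 0) :
    fisherKernel x y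
      = ∫⁻ u in Ioi (0 : ℝ), ENNReal.ofReal (u + x ^ 2)⁻¹ * ENNReal.ofReal (u + y ^ 2)⁻¹ := by
  obtain ⟨hi, he⟩ := integrableOn_and_integral_inv_add_mul_inv_add (a := x ^ 2) (b := y ^ 2)
    (by positivity) (by positivity)
  have h0 : ∀ u ∈ Ioi (0 : ℝ), 0 ≤ (u + x ^ 2)⁻¹ := fun u hu => by
    have : 0 < u := hu
    positivity
  have h1 : ∀ u ∈ Ioi (0 : ℝ), 0 ≤ (u + y ^ 2)⁻¹ := fun u hu => by
    have : 0 < u := hu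
    positivity
  calc fisherKernel x y
      = ENNReal.ofReal (∫ u in Ioi (0 : ℝ), (u + x ^ 2)⁻¹ * (u + y ^ 2)⁻¹) := by
        rw [he, fisherKernel, if_neg (by simp [hx, hy])]
        split_ifs <;> rfl
    _ = ∫⁻ u in Ioi (0 : ℝ), ENNReal.ofReal ((u + x ^ 2)⁻¹ * (u + y ^ 2)⁻¹) := by
        refine ofReal_integral_eq_lintegral_ofReal hi ?_
        filter_upwards [ae_restrict_mem measurableSet_Ioi] with u hu
          using mul_nonneg (h0 u hu) (h1 u hu)
    _ = _ := setLIntegral_congr_fun measurableSet_Ioi fun u hu =>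
        ENNReal.ofReal_mul (h0 u hu)

variable {μ : Measure ℝ}

theorem entropy_eq_coe_integral_log (h0 : ∀ᵐ x ∂μ, x ≠ 0)
    (hi : Integrable (fun x => Real.log |x|) μ) :
    entropy μ = ((∫ x, Real.log |x| ∂μ : ℝ) : EReal) := by
  have e : ∀ x : ℝ, x ≠ 0 → ENNReal.log ‖x‖ₑ = ((Real.log |x| : ℝ) : EReal) := fun x hx => by
    rw [← ofReal_norm, ENNReal.log_ofReal_of_pos (norm_pos_iff.2 hx), Real.norm_eq_abs]
  have h1 : ∫⁻ x, (ENNReal.log ‖x‖ₑ).toENNReal ∂μ = ∫⁻ x, ENNReal.ofReal (Real.log |x|) ∂μ := by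
    refine lintegral_congr_ae ?_
    filter_upwards [h0] with x hx
    rw [e x hx, EReal.toENNReal_of_ne_top (EReal.coe_ne_top _), EReal.toReal_coe]
  have h2 : ∫⁻ x, (-ENNReal.log ‖x‖ₑ).toENNReal ∂μ
      = ∫⁻ x, ENNReal.ofReal (-Real.log |x|) ∂μ := by
    refine lintegral_congr_ae ?_
    filter_upwards [h0] with x hx
    rw [e x hx, ← EReal.coe_neg, EReal.toENNReal_of_ne_top (EReal.coe_ne_top _), EReal.toReal_coe]
  have f1 : ∫⁻ x, ENNReal.ofReal (Real.log |x|) ∂μ ≠ ⊤ := hi.lintegral_lt_top.ne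
  have f2 : ∫⁻ x, ENNReal.ofReal (-Real.log |x|) ∂μ ≠ ⊤ := hi.neg.lintegral_lt_top.ne
  rw [entropy, h1, h2, integral_eq_lintegral_pos_part_sub_lintegral_neg_part hi, EReal.coe_sub,
    EReal.coe_ennreal_toReal f1, EReal.coe_ennreal_toReal f2]

variable [IsProbabilityMeasure μ]

theorem integrable_inv_add_sq {u : ℝ} (hu : 0 < u) :
    Integrable (fun x : ℝ => (u + x ^ 2)⁻¹) μ := by
  refine Integrable.of_bound (by fun_prop) u⁻¹ (Filter.Eventually.of_forall fun x => ?_)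
  rw [Real.norm_of_nonneg (by positivity)]
  gcongr
  nlinarith [sq_nonneg x]

theorem sqStieltjes_pos {u : ℝ} (hu : 0 < u) : 0 < sqStieltjes μ u := by
  rw [sqStieltjes, integral_pos_iff_support_of_nonneg (fun x => by positivity)
    (integrable_inv_add_sq hu)]
  have : Function.support (fun x : ℝ => (u + x ^ 2)⁻¹) = univ := by
    ext x
    simp only [Function.mem_support, mem_univ, iff_true]
    positivity
  simp [this]

theorem measurable_sqStieltjes : Measurable (sqStieltjes μ) :=
  (StronglyMeasurable.integral_prod_right' (ν := μ) (f := fun z : ℝ × ℝ => (z.1 + z.2 ^ 2)⁻¹)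
    (Measurable.stronglyMeasurable (by fun_prop))).measurable

/-- An atom at 0 would give the infinite kernel positive mass. -/
theorem ae_ne_zero_of_fisher_lt_top (h : fisher μ < ⊤) : ∀ᵐ x ∂μ, x ≠ 0 := by
  rw [ae_iff]
  simp only [not_not, ofPred_eq_eq_singleton]
  by_contra h0
  refine h.ne (top_le_iff.1 ?_)
  calc ⊤ = ∫⁻ _ in {(0 : ℝ)}, ⊤ ∂μ := by
        rw [setLIntegral_const, ENNReal.top_mul h0]
    _ ≤ ∫⁻ x in {(0 : ℝ)}, ∫⁻ y, fisherKernel x y ∂μ ∂μ := by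
        refine setLIntegral_mono' (measurableSet_singleton 0) fun x hx => ?_
        rw [mem_singleton_iff] at hx
        simp [fisherKernel, hx]
    _ ≤ fisher μ := setLIntegral_le_lintegral _ _

theorem fisher_eq_lintegral_sq (h : fisher μ < ⊤) :
    fisher μ = ∫⁻ u in Ioi (0 : ℝ), ENNReal.ofReal (sqStieltjes μ u ^ 2) := by
  have h0 := ae_ne_zero_of_fisher_lt_top h
  have hG : ∀ u ∈ Ioi (0 : ℝ), ∫⁻ y, ENNReal.ofReal (u + y ^ 2)⁻¹ ∂μ
      = ENNReal.ofReal (sqStieltjes μ u) := fun u hu => by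
    refine (ofReal_integral_eq_lintegral_ofReal (integrable_inv_add_sq hu)
      (Filter.Eventually.of_forall fun x => ?_)).symm
    have : 0 < u := hu
    positivity
  have hm : Measurable fun z : ℝ × ℝ => ENNReal.ofReal (z.2 + z.1 ^ 2)⁻¹ := by fun_prop
  calc fisher μ = ∫⁻ x, ∫⁻ y, (∫⁻ u in Ioi (0 : ℝ),
        ENNReal.ofReal (u + x ^ 2)⁻¹ * ENNReal.ofReal (u + y ^ 2)⁻¹) ∂μ ∂μ := by
        refine lintegral_congr_ae ?_
        filter_upwards [h0] with x hx
        refine lintegral_congr_ae ?_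
        filter_upwards [h0] with y hy using fisherKernel_eq_lintegral hx hy
    _ = ∫⁻ x, (∫⁻ u in Ioi (0 : ℝ),
          ENNReal.ofReal (u + x ^ 2)⁻¹ * ENNReal.ofReal (sqStieltjes μ u)) ∂μ := by
        refine lintegral_congr fun x => ?_
        rw [lintegral_lintegral_swap (by fun_prop)]
        refine setLIntegral_congr_fun measurableSet_Ioi fun u hu => ?_
        rw [lintegral_const_mul _ (by fun_prop), hG u hu]
    _ = ∫⁻ u in Ioi (0 : ℝ), ENNReal.ofReal (sqStieltjes μ u ^ 2) := by
        rw [lintegral_lintegral_swap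
          (hm.mul (measurable_sqStieltjes.comp measurable_snd).ennreal_ofReal).aemeasurable]
        refine setLIntegral_congr_fun measurableSet_Ioi fun u hu => ?_
        rw [lintegral_mul_const _ (by fun_prop), hG u hu, sq,
          ENNReal.ofReal_mul (sqStieltjes_pos hu).le]

theorem integrableOn_sqStieltjes_sq (h : fisher μ < ⊤) :
    IntegrableOn (fun u => sqStieltjes μ u ^ 2) (Ioi 0) := by
  refine ⟨(measurable_sqStieltjes.pow_const 2).aestronglyMeasurable, ?_⟩
  rw [hasFiniteIntegral_iff_ofReal (Filter.Eventually.of_forall fun u => sq_nonneg _),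
    ← fisher_eq_lintegral_sq h]
  exact h

theorem toReal_fisher (h : fisher μ < ⊤) :
    (fisher μ).toReal = ∫ u in Ioi (0 : ℝ), sqStieltjes μ u ^ 2 := by
  rw [fisher_eq_lintegral_sq h, integral_eq_lintegral_of_nonneg_ae
    (Filter.Eventually.of_forall fun u => sq_nonneg _)
    (measurable_sqStieltjes.pow_const 2).aestronglyMeasurable]

/-- This licenses Fubini for the entropy formula. Split at u = 1: below it the two terms are
integrable separately, above it only their difference decays like u⁻². -/
theorem integrable_inv_sub_inv (h : fisher μ < ⊤) (hμ : Integrable (fun x : ℝ => x ^ 2) μ) :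
    Integrable (fun z : ℝ × ℝ => (1 + z.1)⁻¹ - (z.1 + z.2 ^ 2)⁻¹)
      ((volume.restrict (Ioi 0)).prod μ) := by
  have hm : ∀ ν : Measure (ℝ × ℝ), AEStronglyMeasurable
      (fun z : ℝ × ℝ => (1 + z.1)⁻¹ - (z.1 + z.2 ^ 2)⁻¹) ν := fun ν =>
    Measurable.aestronglyMeasurable (by fun_prop)
  have hsplit : (volume.restrict (Ioi (0 : ℝ))).prod μ
      = ((volume.restrict (Ioc 0 1)).prod μ) + ((volume.restrict (Ioi 1)).prod μ) := by
    rw [← Ioc_union_Ioi_eq_Ioi zero_le_one, Measure.restrict_union Ioc_disjoint_Ioi_same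
      measurableSet_Ioi, Measure.add_prod]
  have hmem : ∀ s : Set ℝ, MeasurableSet s →
      ∀ᵐ z ∂((volume.restrict s).prod μ), z.1 ∈ s := fun s hs =>
    Measure.quasiMeasurePreserving_fst.ae (ae_restrict_mem hs)
  rw [hsplit, integrable_add_measure]
  constructor
  · refine Integrable.sub ?_ ?_
    · have h1 : Integrable (fun _ : ℝ × ℝ => (1 : ℝ)) ((volume.restrict (Ioc (0 : ℝ) 1)).prod μ) :=
        integrable_const _
      refine h1.mono' (Measurable.aestronglyMeasurable (by fun_prop)) ?_
      filter_upwards [hmem _ measurableSet_Ioc] with z hz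
      have : 0 < z.1 := hz.1
      rw [Real.norm_of_nonneg (by positivity)]
      exact inv_le_one_of_one_le₀ (by linarith)
    · rw [integrable_prod_iff (Measurable.aestronglyMeasurable (by fun_prop))]
      constructor
      · filter_upwards [ae_restrict_mem measurableSet_Ioc] with u hu
          using integrable_inv_add_sq hu.1
      · have hi : IntegrableOn (fun u => 1 + sqStieltjes μ u ^ 2) (Ioc 0 1) :=
          Integrable.add (integrable_const _)
            ((integrableOn_sqStieltjes_sq h).mono_set Ioc_subset_Ioi_self)
        have hi' : IntegrableOn (sqStieltjes μ) (Ioc 0 1) := by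
          refine Integrable.mono' hi measurable_sqStieltjes.aestronglyMeasurable ?_
          filter_upwards [ae_restrict_mem measurableSet_Ioc] with u hu
          rw [Real.norm_of_nonneg (sqStieltjes_pos hu.1).le]
          nlinarith [sq_nonneg (sqStieltjes μ u - 1), sq_nonneg (sqStieltjes μ u)]
        refine hi'.congr ?_
        filter_upwards [ae_restrict_mem measurableSet_Ioc] with u hu
        refine integral_congr_ae (Filter.Eventually.of_forall fun x => ?_)
        have : 0 < u := hu.1
        exact (Real.norm_of_nonneg (by positivity)).symm
  · have h1 : IntegrableOn (fun u : ℝ => u ^ (-2 : ℝ)) (Ioi 1) :=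
      integrableOn_Ioi_rpow_of_lt (by norm_num) one_pos
    have h2 : Integrable (fun x : ℝ => 1 + x ^ 2) μ := (integrable_const _).add hμ
    refine (Integrable.mul_prod h1 h2).mono' (hm _) ?_
    filter_upwards [hmem _ measurableSet_Ioi] with z hz
    have hz0 : 0 < z.1 := one_pos.trans hz
    have e : (1 + z.1)⁻¹ - (z.1 + z.2 ^ 2)⁻¹
        = (z.2 ^ 2 - 1) * ((1 + z.1)⁻¹ * (z.1 + z.2 ^ 2)⁻¹) := by
      have : 1 + z.1 ≠ 0 := by positivity
      have : z.1 + z.2 ^ 2 ≠ 0 := by positivity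
      field_simp
      ring
    have h3 : |z.2 ^ 2 - 1| ≤ 1 + z.2 ^ 2 := by
      rw [abs_le]; constructor <;> nlinarith [sq_nonneg z.2]
    have h4 : (1 + z.1)⁻¹ ≤ z.1⁻¹ := inv_anti₀ hz0 (by linarith)
    have h5 : (z.1 + z.2 ^ 2)⁻¹ ≤ z.1⁻¹ := inv_anti₀ hz0 (by nlinarith [sq_nonneg z.2])
    rw [e, norm_mul, Real.norm_eq_abs, Real.norm_of_nonneg (by positivity), mul_comm,
      Real.rpow_neg hz0.le, Real.rpow_two, sq z.1, mul_inv]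
    gcongr

theorem integral_inv_sub_inv {x : ℝ} (hx : x ≠ 0) :
    ∫ u in Ioi (0 : ℝ), ((1 + u)⁻¹ - (u + x ^ 2)⁻¹) = 2 * Real.log |x| := by
  have hx2 : 0 < x ^ 2 := by positivity
  have e : ∀ u ∈ Ioi (0 : ℝ), (1 + u)⁻¹ - (u + x ^ 2)⁻¹
      = (x ^ 2 - 1) * ((u + x ^ 2)⁻¹ * (u + 1)⁻¹) := fun u hu => by
    have hu : 0 < u := hu
    have : 1 + u ≠ 0 := by positivity
    have : u + 1 ≠ 0 := by positivity
    have : u + x ^ 2 ≠ 0 := by positivity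
    field_simp
    ring
  rw [setIntegral_congr_fun measurableSet_Ioi e, integral_const_mul,
    (integrableOn_and_integral_inv_add_mul_inv_add hx2 one_pos).2, Real.log_abs]
  split_ifs with h1
  · have := congrArg Real.log h1
    rw [Real.log_pow, Real.log_one] at this
    push_cast at this
    rw [this, h1]
    simp
  · rw [Real.log_one, sub_zero, mul_div_cancel₀ _ (sub_ne_zero.2 h1), Real.log_pow]
    norm_num

theorem integrableOn_inv_sub_sqStieltjes (h : fisher μ < ⊤)
    (hμ : Integrable (fun x : ℝ => x ^ 2) μ) :
    IntegrableOn (fun u => (1 + u)⁻¹ - sqStieltjes μ u) (Ioi 0) := by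
  refine (integrable_inv_sub_inv h hμ).integral_prod_left.congr ?_
  filter_upwards [ae_restrict_mem measurableSet_Ioi] with u hu
  rw [integral_sub (integrable_const _) (integrable_inv_add_sq hu)]
  simp [sqStieltjes]

theorem entropy_eq_coe_integral_sqStieltjes (h : fisher μ < ⊤)
    (hμ : Integrable (fun x : ℝ => x ^ 2) μ) :
    entropy μ
      = ((1 / 2 * ∫ u in Ioi (0 : ℝ), ((1 + u)⁻¹ - sqStieltjes μ u) : ℝ) : EReal) := by
  have h0 := ae_ne_zero_of_fisher_lt_top h
  have hi := integrable_inv_sub_inv h hμ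
  have hlog : Integrable (fun x => Real.log |x|) μ := by
    refine (hi.integral_prod_right.const_mul (1 / 2)).congr ?_
    filter_upwards [h0] with x hx
    rw [integral_inv_sub_inv hx]
    ring
  rw [entropy_eq_coe_integral_log h0 hlog, EReal.coe_eq_coe_iff]
  calc ∫ x, Real.log |x| ∂μ
      = ∫ x, (1 / 2 * ∫ u in Ioi (0 : ℝ), ((1 + u)⁻¹ - (u + x ^ 2)⁻¹)) ∂μ := by
        refine integral_congr_ae ?_
        filter_upwards [h0] with x hx
        rw [integral_inv_sub_inv hx]
        ring
    _ = 1 / 2 * ∫ u in Ioi (0 : ℝ), (∫ x, ((1 + u)⁻¹ - (u + x ^ 2)⁻¹) ∂μ) := by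
        rw [integral_const_mul, ← integral_integral_swap hi]
    _ = _ := by
        congr 1
        refine setIntegral_congr_fun measurableSet_Ioi fun u hu => ?_
        simp only [integral_sub (integrable_const _) (integrable_inv_add_sq hu)]
        simp [sqStieltjes]

end Analysis

/-! ### Integration along the flow 1/g_s = 1/g_0 + s. -/

section DeBruijn

theorem integral_div_one_add_mul_sq {g t : ℝ} (hg : 0 < g) (ht : 0 ≤ t) :
    ∫ s in (0 : ℝ)..t, (g / (1 + s * g)) ^ 2 = g - g / (1 + t * g) := by
  have h1 : ∀ s ∈ uIcc 0 t, 1 + s * g ≠ 0 := fun s hs => by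
    rw [uIcc_of_le ht] at hs
    have := hs.1
    positivity
  have hderiv : ∀ s ∈ uIcc 0 t,
      HasDerivAt (fun s => -g * (1 + s * g)⁻¹) ((g / (1 + s * g)) ^ 2) s := fun s hs => by
    have h := h1 s hs
    convert! ((((hasDerivAt_id s).mul_const g).const_add 1).inv h).const_mul (-g) using 1
    simp only [id]
    field_simp
  have hcont : ContinuousOn (fun s => (g / (1 + s * g)) ^ 2) (uIcc 0 t) :=
    (ContinuousOn.div (by fun_prop) (by fun_prop) h1).pow 2
  rw [intervalIntegral.integral_eq_sub_of_hasDerivAt hderiv hcont.intervalIntegrable]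
  simp
  ring

variable {ν : ℝ → Measure ℝ} {t : ℝ}

/-- The de Bruijn identity for a family of measures whose transforms `sqStieltjes` evolve by
`1 / g ↦ 1 / g + s`. -/
theorem deBruijn_of_sqStieltjes (ht : 0 ≤ t) (hprob : ∀ s ∈ Icc 0 t, IsProbabilityMeasure (ν s))
    (hsq : ∀ s ∈ Icc 0 t, Integrable (fun x : ℝ => x ^ 2) (ν s))
    (hfin : ∀ s ∈ Icc 0 t, fisher (ν s) < ⊤)
    (hg : ∀ s ∈ Icc 0 t, ∀ u, 0 < u → sqStieltjes (ν s) u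
      = sqStieltjes (ν 0) u - s * (sqStieltjes (ν 0) u * sqStieltjes (ν s) u)) :
    (∀ s ∈ Icc 0 t, entropy (ν s) ≠ ⊥) ∧
    IntervalIntegrable (fun s : ℝ => (1 / 2 : ℝ) * (fisher (ν s)).toReal) volume 0 t ∧
    (entropy (ν t)).toReal - (entropy (ν 0)).toReal
      = ∫ s in (0 : ℝ)..t, (1 / 2 : ℝ) * (fisher (ν s)).toReal ∧
    StrictMonoOn (fun s : ℝ => entropy (ν s)) (Icc 0 t) := by
  have h0 : (0 : ℝ) ∈ Icc 0 t := left_mem_Icc.2 ht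
  have htt : t ∈ Icc 0 t := right_mem_Icc.2 ht
  have hP0 := hprob 0 h0
  have hgpos : ∀ s ∈ Icc 0 t, ∀ u, 0 < u → 0 < sqStieltjes (ν s) u := fun s hs u hu => by
    have := hprob s hs
    exact sqStieltjes_pos hu
  have hent : ∀ s ∈ Icc 0 t, entropy (ν s)
      = ((1 / 2 * ∫ u in Ioi (0 : ℝ), ((1 + u)⁻¹ - sqStieltjes (ν s) u) : ℝ) : EReal) :=
    fun s hs => by
      have := hprob s hs
      exact entropy_eq_coe_integral_sqStieltjes (hfin s hs) (hsq s hs)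
  have hint : ∀ s ∈ Icc 0 t,
      IntegrableOn (fun u => (1 + u)⁻¹ - sqStieltjes (ν s) u) (Ioi 0) := fun s hs => by
    have := hprob s hs
    exact integrableOn_inv_sub_sqStieltjes (hfin s hs) (hsq s hs)
  have hgs : ∀ s ∈ Icc 0 t, ∀ u, 0 < u →
      sqStieltjes (ν s) u = sqStieltjes (ν 0) u / (1 + s * sqStieltjes (ν 0) u) :=
    fun s hs u hu => by
      have := hgpos 0 h0 u hu
      have hs0 := hs.1
      rw [eq_div_iff (by positivity)]
      linarith [hg s hs u hu]
  set f : ℝ → ℝ → ℝ := fun s u => (sqStieltjes (ν 0) u / (1 + s * sqStieltjes (ν 0) u)) ^ 2 with hf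
  have hfisher : ∀ s ∈ Icc 0 t, (fisher (ν s)).toReal = ∫ u in Ioi (0 : ℝ), f s u :=
    fun s hs => by
      have := hprob s hs
      rw [toReal_fisher (hfin s hs)]
      exact setIntegral_congr_fun measurableSet_Ioi fun u hu => by rw [hgs s hs u hu]
  have hfint : Integrable (Function.uncurry f)
      ((volume.restrict (uIoc 0 t)).prod (volume.restrict (Ioi 0))) := by
    have hm : Measurable (Function.uncurry f) := by
      have : Measurable fun z : ℝ × ℝ => sqStieltjes (ν 0) z.2 :=
        measurable_sqStieltjes.comp measurable_snd
      exact (this.div ((measurable_fst.mul this).const_add 1)).pow_const 2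
    have h1 : Integrable (fun _ : ℝ => (1 : ℝ)) (volume.restrict (uIoc 0 t)) :=
      integrableOn_const (by simp)
    -- The flow decreases the transform, so g_0² dominates uniformly in s and Fubini applies.
    refine (Integrable.mul_prod h1 (integrableOn_sqStieltjes_sq (hfin 0 h0))).mono'
      hm.aestronglyMeasurable ?_
    filter_upwards [Measure.quasiMeasurePreserving_fst.ae (ae_restrict_mem measurableSet_uIoc),
      Measure.quasiMeasurePreserving_snd.ae (ae_restrict_mem measurableSet_Ioi)] with z hz1 hz2
    rw [uIoc_of_le ht] at hz1
    have hg0 := hgpos 0 h0 z.2 hz2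
    have hz0 : 0 < z.1 := hz1.1
    have : sqStieltjes (ν 0) z.2 / (1 + z.1 * sqStieltjes (ν 0) z.2) ≤ sqStieltjes (ν 0) z.2 :=
      div_le_self hg0.le (le_add_of_nonneg_right (by positivity))
    have e : Function.uncurry f z
        = (sqStieltjes (ν 0) z.2 / (1 + z.1 * sqStieltjes (ν 0) z.2)) ^ 2 := rfl
    rw [e, Real.norm_of_nonneg (sq_nonneg _), one_mul]
    exact pow_le_pow_left₀ (by positivity) this 2
  refine ⟨fun s hs => by rw [hent s hs]; exact EReal.coe_ne_bot _, ?_, ?_, ?_⟩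
  · refine IntervalIntegrable.const_mul ?_ _
    rw [intervalIntegrable_iff]
    refine hfint.integral_prod_left.congr ?_
    filter_upwards [ae_restrict_mem measurableSet_uIoc] with s hs
    rw [uIoc_of_le ht] at hs
    exact (hfisher s (Ioc_subset_Icc_self hs)).symm
  · rw [hent t htt, hent 0 h0, EReal.toReal_coe, EReal.toReal_coe, ← mul_sub,
      ← integral_sub (hint t htt) (hint 0 h0), intervalIntegral.integral_const_mul]
    congr 1
    calc ∫ u in Ioi (0 : ℝ), ((1 + u)⁻¹ - sqStieltjes (ν t) u - ((1 + u)⁻¹ - sqStieltjes (ν 0) u))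
        = ∫ u in Ioi (0 : ℝ), (∫ s in (0 : ℝ)..t, f s u) := by
          refine setIntegral_congr_fun measurableSet_Ioi fun u hu => ?_
          simp only [hf]
          rw [integral_div_one_add_mul_sq (hgpos 0 h0 u hu) ht, hgs t htt u hu]
          ring
      _ = ∫ s in (0 : ℝ)..t, (∫ u in Ioi (0 : ℝ), f s u) :=
          (intervalIntegral_integral_swap hfint).symm
      _ = _ := by
          refine intervalIntegral.integral_congr fun s hs => ?_
          rw [uIcc_of_le ht] at hs
          exact (hfisher s hs).symm
  · intro a ha b hb hab
    have hlt : ∀ u ∈ Ioi (0 : ℝ), sqStieltjes (ν b) u < sqStieltjes (ν a) u := fun u hu => by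
      have hg0 := hgpos 0 h0 u hu
      have ha0 := ha.1
      rw [hgs a ha u hu, hgs b hb u hu]
      gcongr
    simp only [hent a ha, hent b hb, EReal.coe_lt_coe_iff]
    refine mul_lt_mul_of_pos_left ?_ (by norm_num)
    rw [← sub_pos, ← integral_sub (hint b hb) (hint a ha)]
    -- The entropy gap is half the integral of g_a - g_b, which is positive on all of (0, ∞).
    refine (setIntegral_pos_iff_support_of_nonneg_ae ?_ ((hint b hb).sub (hint a ha))).2 ?_
    rotate_left
    · refine lt_of_lt_of_le (b := volume (Ioi (0 : ℝ))) (by simp) (measure_mono fun u hu => ?_)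
      refine ⟨?_, hu⟩
      have := hlt u hu
      rw [Function.mem_support, Pi.sub_apply]
      exact ne_of_gt (by linarith)
    · filter_upwards [ae_restrict_mem measurableSet_Ioi] with u hu
      have := hlt u hu
      rw [Pi.zero_apply, Pi.sub_apply]
      linarith

end DeBruijn

end BooleanEntropy

end

theorem mainTheorem1 {M : Type*} [CStarAlgebra M] [PartialOrder M] [StarOrderedRing M]
    [WStarAlgebra M] (τ : M →ₚ[ℂ] ℂ) (hτ_one : τ 1 = 1) (hτ_normal : BooleanEntropy.IsNormal τ)
    (X B : M) (hX : IsSelfAdjoint X) (hB : IsSelfAdjoint B)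
    (hX_symm : BooleanEntropy.IsSymm (BooleanEntropy.law τ X))
    (hB_law : BooleanEntropy.law τ B = BooleanEntropy.rademacher)
    (h_indep : BooleanEntropy.BooleanIndep τ X B)
    (t : ℝ) (ht : 0 ≤ t)
    (h_fin : ∀ s ∈ Set.Icc 0 t,
      BooleanEntropy.entropy (BooleanEntropy.law τ (X + ((√s : ℝ) : ℂ) • B)) < ⊤ ∧
      BooleanEntropy.fisher (BooleanEntropy.law τ (X + ((√s : ℝ) : ℂ) • B)) < ⊤) :
    (∀ s ∈ Set.Icc 0 t,
      BooleanEntropy.entropy (BooleanEntropy.law τ (X + ((√s : ℝ) : ℂ) • B)) ≠ ⊥) ∧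
    IntervalIntegrable
      (fun s : ℝ => (1 / 2 : ℝ) *
        (BooleanEntropy.fisher (BooleanEntropy.law τ (X + ((√s : ℝ) : ℂ) • B))).toReal)
      MeasureTheory.volume 0 t ∧
    (BooleanEntropy.entropy (BooleanEntropy.law τ (X + ((√t : ℝ) : ℂ) • B))).toReal
        - (BooleanEntropy.entropy (BooleanEntropy.law τ X)).toReal
      = ∫ s in (0 : ℝ)..t, (1 / 2 : ℝ) *
          (BooleanEntropy.fisher (BooleanEntropy.law τ (X + ((√s : ℝ) : ℂ) • B))).toReal ∧
    StrictMonoOn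
      (fun s : ℝ => BooleanEntropy.entropy (BooleanEntropy.law τ (X + ((√s : ℝ) : ℂ) • B)))
      (Set.Icc 0 t) := by
  have hY : ∀ s : ℝ, IsSelfAdjoint (X + ((√s : ℝ) : ℂ) • B) := fun s =>
    hX.add (IsSelfAdjoint.smul (Complex.conj_ofReal _) hB)
  have hlaw := fun s : ℝ => BooleanEntropy.isLaw_law τ hτ_one (hY s)
  have hX0 : X + ((√(0 : ℝ) : ℝ) : ℂ) • B = X := by simp
  have key := BooleanEntropy.deBruijn_of_sqStieltjes
    (ν := fun s => BooleanEntropy.law τ (X + ((√s : ℝ) : ℂ) • B)) ht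
    (fun s _ => (hlaw s).isProbabilityMeasure) (fun s _ => (hlaw s).integrable_pow 2)
    (fun s hs => (h_fin s hs).2) (fun s hs u hu => by
      simp only [hX0]
      exact BooleanEntropy.sqStieltjes_law_add_smul hτ_one hX hB hX_symm hB_law h_indep hs.1 hu)
  simp only [hX0] at key
  exact key
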